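/- Let $cs$ be the complex vector space of all sequences $x=(x_n)_{n\ge 0}$ of complex numbers whose series $\sum_{n\ge 0} x_n$ converges, with the norm $\|x\|_{cs}=\sup_{n\ge 0}\bigl|\sum_{k=0}^n x_k\bigr|$. Let $0\le t<1$, and let $C_t$ be the generalized Cesàro operator $$C_t x=\left(\frac{t^n x_0+t^{n-1}x_1+\dots+x_n}{n+1}\right)_{n\ge 0}\qquad(\text{with } 0^0=1).$$ Put $\Lambda=\{\tfrac1{n+1}: n=0,1,2,\dots\}$ and $\Lambda_0=\Lambda\cup\{0\}$. Then $C_t$ maps $cs$ into itself and is a bounded linear operator there, with the following properties. 1. $\|C_t\|_{cs\to cs}=t^{-1}\log\bigl(1/(1-t)\bigr)$ if $0<t<1$, and $\|C_0\|_{cs\to cs}=1$. 2. $C_t$ is a compact operator on $cs$. 3. The point spectrum $\sigma_{pt}(C_t;cs)=\{\lambda\in\mathbb C:\lambda I-C_t\text{ is not injective on } cs\}$ equals $\Lambda$, and the spectrum $\sigma(C_t;cs)$ equals $\Lambda_0$. 4. $C_t$ is power bounded, that is, $\sup_{n\ge 1}\|C_t^n\|_{cs\to cs}<\infty$. 5.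 $C_t$ is uniformly mean ergodic, that is, the averages $\frac1n\sum_{m=1}^n C_t^m$ converge in the operator norm as $n\to\infty$. 6. $C_t$ is not supercyclic, that is, there is no $x\in cs$ for which $\{\lambda C_t^n x:\lambda\in\mathbb C,\ n\ge 0\}$ is dense in $cs$. -/

import Mathlib

open Filter Topology

/-- The `N`-th partial sum `x_0 + … + x_N` of the series with terms `x`. -/
def seriesPartialSum (x : ℕ → ℂ) (N : ℕ) : ℂ := ∑ k ∈ Finset.range (N + 1), x k

/-- The complex sequences whose series converges, as a linear subspace of `ℂ^ℕ`. -/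
def convSeriesSubmodule : Submodule ℂ (ℕ → ℂ) where
  carrier := {x | ∃ l : ℂ, Tendsto (seriesPartialSum x) atTop (𝓝 l)}
  zero_mem' := ⟨0, by
    have h : seriesPartialSum 0 = fun _ => 0 := by funext N; simp [seriesPartialSum]
    rw [h]; exact tendsto_const_nhds⟩
  add_mem' := by
    rintro x y ⟨a, ha⟩ ⟨b, hb⟩
    refine ⟨a + b, (ha.add hb).congr fun N => ?_⟩
    simp [seriesPartialSum, Finset.sum_add_distrib]
  smul_mem' := by
    rintro c x ⟨a, ha⟩
    refine ⟨c * a, (ha.const_mul c).congr fun N => ?_⟩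
    simp [seriesPartialSum, Finset.mul_sum]

/-- The space `cs` of convergent series. It is a type of its own, so that it does not inherit the
topology of coordinatewise convergence from `ℂ^ℕ`. -/
def ConvSeries : Type := convSeriesSubmodule

namespace ConvSeries

instance : AddCommGroup ConvSeries := inferInstanceAs (AddCommGroup convSeriesSubmodule)

instance : Module ℂ ConvSeries := inferInstanceAs (Module ℂ convSeriesSubmodule)

/-- The underlying sequence of an element of `cs`. -/
def seq (x : ConvSeries) : ℕ → ℂ := x.1

theorem seq_injective : Function.Injective seq := Subtype.val_injective

theorem seq_zero : seq 0 = 0 := rfl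

theorem seq_add (x y : ConvSeries) : seq (x + y) = seq x + seq y := rfl

theorem seq_neg (x : ConvSeries) : seq (-x) = -seq x := rfl

theorem seq_smul (c : ℂ) (x : ConvSeries) : seq (c • x) = c • seq x := rfl

/-- The norm of `cs`: the supremum of the moduli of the partial sums. -/
noncomputable instance : Norm ConvSeries := ⟨fun x => ⨆ N : ℕ, ‖seriesPartialSum x.seq N‖⟩

theorem norm_def (x : ConvSeries) : ‖x‖ = ⨆ N : ℕ, ‖seriesPartialSum x.seq N‖ := rfl

theorem bddAbove_partialSum (x : ConvSeries) :
    BddAbove (Set.range fun N : ℕ => ‖seriesPartialSum x.seq N‖) := by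
  obtain ⟨l, hl⟩ := x.2
  exact hl.norm.bddAbove_range

theorem norm_partialSum_le (x : ConvSeries) (N : ℕ) : ‖seriesPartialSum x.seq N‖ ≤ ‖x‖ :=
  le_ciSup (bddAbove_partialSum x) N

theorem norm_core : NormedSpace.Core ℂ ConvSeries where
  norm_nonneg x := (norm_nonneg _).trans (norm_partialSum_le x 0)
  norm_smul c x := by
    rw [norm_def, norm_def, Real.mul_iSup_of_nonneg (norm_nonneg c)]
    refine iSup_congr fun N => ?_
    rw [← norm_mul, seq_smul]
    simp [seriesPartialSum, Finset.mul_sum]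
  norm_triangle x y := by
    refine ciSup_le fun N => ?_
    have h : seriesPartialSum (x + y).seq N
        = seriesPartialSum x.seq N + seriesPartialSum y.seq N := by
      simp [seriesPartialSum, seq_add, Finset.sum_add_distrib]
    rw [h]
    exact (norm_add_le _ _).trans (add_le_add (norm_partialSum_le x N) (norm_partialSum_le y N))
  norm_eq_zero_iff x := by
    constructor
    · intro hx
      have h : ∀ N, seriesPartialSum x.seq N = 0 := fun N =>
        norm_le_zero_iff.mp ((norm_partialSum_le x N).trans hx.le)
      apply seq_injective
      funext n
      rw [seq_zero]
      cases n with
      | zero => simpa [seriesPartialSum] using h 0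
      | succ n =>
        have h1 := h (n + 1)
        rw [seriesPartialSum, Finset.sum_range_succ] at h1
        have h2 := h n
        rw [seriesPartialSum] at h2
        simpa [h2] using h1
    · rintro rfl
      simp [norm_def, seq_zero, seriesPartialSum]

noncomputable instance : NormedAddCommGroup ConvSeries := NormedAddCommGroup.ofCore norm_core

noncomputable instance : NormedSpace ℂ ConvSeries := NormedSpace.ofCore norm_core

end ConvSeries

/-- The generalized Cesàro operator on all complex sequences,
`(C_t x)_n = (t^n x_0 + t^(n-1) x_1 + … + x_n) / (n + 1)`, with `0 ^ 0 = 1`. -/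
noncomputable def generalizedCesaro (t : ℝ) (x : ℕ → ℂ) (n : ℕ) : ℂ :=
  (∑ k ∈ Finset.range (n + 1), (t : ℂ) ^ (n - k) * x k) / ((n : ℂ) + 1)

section Operators

variable {X : Type*} [NormedAddCommGroup X] [NormedSpace ℂ X]

/-- The point spectrum: all `μ` such that `μ I - T` is not injective. -/
def pointSpectrum (T : X →L[ℂ] X) : Set ℂ :=
  {μ | ¬ Function.Injective (μ • ContinuousLinearMap.id ℂ X - T)}

/-- `T` is power bounded: `sup_{n ≥ 1} ‖T ^ n‖ < ∞`. -/
def IsPowerBounded (T : X →L[ℂ] X) : Prop :=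
  ∃ M : ℝ, ∀ n : ℕ, 1 ≤ n → ‖T ^ n‖ ≤ M

/-- The Cesàro means `(1 / n) (T + T ^ 2 + … + T ^ n)` (for `n ≥ 1`). -/
noncomputable def cesaroMean (T : X →L[ℂ] X) (n : ℕ) : X →L[ℂ] X :=
  (n : ℂ)⁻¹ • ∑ m ∈ Finset.Icc 1 n, T ^ m

/-- `T` is uniformly mean ergodic: its Cesàro means converge in the operator norm. -/
def IsUniformlyMeanErgodic (T : X →L[ℂ] X) : Prop :=
  ∃ P : X →L[ℂ] X, Tendsto (cesaroMean T) atTop (𝓝 P)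

/-- `T` is supercyclic: some projective orbit `{μ T ^ n x : μ ∈ ℂ, n ≥ 0}` is dense. -/
def IsSupercyclic (T : X →L[ℂ] X) : Prop :=
  ∃ x : X, Dense {y : X | ∃ (μ : ℂ) (n : ℕ), y = μ • (T ^ n) x}

end Operators

/-! `C_t` convolves with `t ^ n` and then multiplies by the decreasing weights `1 / (n + 1)`.
Grouping the double sum by powers of `t` and applying Abel's inequality to each group gives `‖C_t‖ ≤
∑ t ^ j / (j + 1)`, with equality at `e_0`. The same inequality shows that dropping all coordinates
from `M` on costs `O(1 / M)`, so `C_t` is a norm limit of finite-rank operators.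

The matrix is lower triangular with diagonal `1 / (n + 1)`, which confines the eigenvalues; binomial
sequences realise all of them. Compactness turns this into the spectrum. If `P` is the rank-one
projection `x ↦ x_0 v` onto the fixed vectors, then `C_t - P` has spectral radius below `1`, so `C_t
^ n → P` in norm (`exists_tendsto_pow_cesaro`). This yields power boundedness and uniform mean
ergodicity. Supercyclicity fails because the adjoint has eigenvalues `1` and `1 / 2`. -/

/-! ### Abel summation and geometric convolution. -/

/-- Abel's inequality for antitone nonnegative weights. -/
theorem norm_sum_range_mul_le_of_antitone {w : ℕ → ℝ} (hw : Antitone w) (hw0 : ∀ n, 0 ≤ w n)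
    {x : ℕ → ℂ} {B : ℝ} (hB : ∀ n, ‖∑ k ∈ Finset.range n, x k‖ ≤ B) (N : ℕ) :
    ‖∑ k ∈ Finset.range N, (w k : ℂ) * x k‖ ≤ w 0 * B := by
  -- With the boundary term subtracted, each step adds only `w N - w (N + 1)` times a partial sum,
  -- and the bounds telescope.
  have key : ∀ N, ‖∑ k ∈ Finset.range N, (w k : ℂ) * x k
      - (w N : ℂ) * ∑ k ∈ Finset.range N, x k‖ ≤ (w 0 - w N) * B := by
    intro N
    induction N with
    | zero => simp
    | succ N ih =>
      have e : ∑ k ∈ Finset.range (N + 1), (w k : ℂ) * x k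
            - (w (N + 1) : ℂ) * ∑ k ∈ Finset.range (N + 1), x k
          = (∑ k ∈ Finset.range N, (w k : ℂ) * x k - (w N : ℂ) * ∑ k ∈ Finset.range N, x k)
            + ((w N - w (N + 1) : ℝ) : ℂ) * ∑ k ∈ Finset.range (N + 1), x k := by
        simp only [Finset.sum_range_succ]
        push_cast
        ring
      have hd : 0 ≤ w N - w (N + 1) := sub_nonneg.2 (hw N.le_succ)
      rw [e]
      refine (norm_add_le _ _).trans ?_
      rw [norm_mul, Complex.norm_of_nonneg hd]
      have := mul_le_mul_of_nonneg_left (hB (N + 1)) hd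
      linarith
  have h1 := norm_le_norm_sub_add (∑ k ∈ Finset.range N, (w k : ℂ) * x k)
    ((w N : ℂ) * ∑ k ∈ Finset.range N, x k)
  have h2 : ‖(w N : ℂ) * ∑ k ∈ Finset.range N, x k‖ ≤ w N * B := by
    rw [norm_mul, Complex.norm_of_nonneg (hw0 N)]
    exact mul_le_mul_of_nonneg_left (hB N) (hw0 N)
  linarith [key N]

/-- The convolution of `x` with the geometric sequence `t ^ n`. -/
noncomputable def geomConv (t : ℝ) (x : ℕ → ℂ) (n : ℕ) : ℂ :=
  ∑ k ∈ Finset.range (n + 1), (t : ℂ) ^ (n - k) * x k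

theorem antitone_one_div_natCast_add_one : Antitone fun n : ℕ => 1 / ((n : ℝ) + 1) :=
  fun _ _ h => Nat.one_div_le_one_div h

theorem generalizedCesaro_eq_mul_geomConv (t : ℝ) (x : ℕ → ℂ) (n : ℕ) :
    generalizedCesaro t x n = ((1 / ((n : ℝ) + 1) : ℝ) : ℂ) * geomConv t x n := by
  simp [generalizedCesaro, geomConv, div_eq_inv_mul]

theorem sum_range_mul_geomConv (t : ℝ) (w x : ℕ → ℂ) (N : ℕ) :
    ∑ n ∈ Finset.range N, w n * geomConv t x n
      = ∑ j ∈ Finset.range N, (t : ℂ) ^ j * ∑ k ∈ Finset.range (N - j), w (j + k) * x k := by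
  simp only [Finset.mul_sum]
  rw [← Finset.sum_range_diag_flip N fun j k => (t : ℂ) ^ j * (w (j + k) * x k)]
  refine Finset.sum_congr rfl fun n _ => ?_
  rw [geomConv, Finset.mul_sum, ← Finset.sum_flip]
  refine Finset.sum_congr rfl fun j hj => ?_
  have hj' : j ≤ n := Nat.lt_succ_iff.1 (Finset.mem_range.1 hj)
  rw [Nat.sub_sub_self hj', Nat.add_sub_cancel' hj']
  ring

/-- For each lag `j` the shifted weights `w (j + k)` are still antitone and start at `w j`, so
Abel's inequality applies lag by lag. -/
theorem norm_sum_range_mul_geomConv_le {t : ℝ} (ht0 : 0 ≤ t) {w : ℕ → ℝ} (hw : Antitone w)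
    (hw0 : ∀ n, 0 ≤ w n) {x : ℕ → ℂ} {B : ℝ} (hB : ∀ n, ‖∑ k ∈ Finset.range n, x k‖ ≤ B)
    (N : ℕ) :
    ‖∑ n ∈ Finset.range N, (w n : ℂ) * geomConv t x n‖
      ≤ (∑ j ∈ Finset.range N, t ^ j * w j) * B := by
  rw [sum_range_mul_geomConv t (fun n => (w n : ℂ)), Finset.sum_mul]
  refine (norm_sum_le _ _).trans (Finset.sum_le_sum fun j _ => ?_)
  rw [norm_mul, norm_pow, Complex.norm_of_nonneg ht0, mul_assoc]
  refine mul_le_mul_of_nonneg_left ?_ (pow_nonneg ht0 j)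
  exact norm_sum_range_mul_le_of_antitone (w := fun k => w (j + k))
    (fun a b h => hw (Nat.add_le_add_left h j)) (fun n => hw0 _) hB _

theorem geom_sum_range_le {t : ℝ} (ht0 : 0 ≤ t) (ht1 : t < 1) (N : ℕ) :
    ∑ j ∈ Finset.range N, t ^ j ≤ (1 - t)⁻¹ :=
  (Summable.sum_le_tsum _ (fun j _ => pow_nonneg ht0 j)
    (summable_geometric_of_lt_one ht0 ht1)).trans_eq (tsum_geometric_of_lt_one ht0 ht1)

theorem norm_sum_range_geomConv_le {t : ℝ} (ht0 : 0 ≤ t) (ht1 : t < 1) {x : ℕ → ℂ} {B : ℝ}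
    (hB : ∀ n, ‖∑ k ∈ Finset.range n, x k‖ ≤ B) (N : ℕ) :
    ‖∑ n ∈ Finset.range N, geomConv t x n‖ ≤ (1 - t)⁻¹ * B := by
  have h := norm_sum_range_mul_geomConv_le ht0 (w := fun _ => 1) antitone_const
    (fun _ => zero_le_one) hB N
  simp only [Complex.ofReal_one, one_mul, mul_one] at h
  -- The empty sum in `hB 0` gives `0 ≤ B`.
  exact h.trans (mul_le_mul_of_nonneg_right (geom_sum_range_le ht0 ht1 N) (by simpa using hB 0))

/-! ### The Banach space `cs`. -/

namespace ConvSeries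

theorem norm_sum_range_le (x : ConvSeries) (n : ℕ) : ‖∑ k ∈ Finset.range n, x.seq k‖ ≤ ‖x‖ := by
  cases n with
  | zero => simp
  | succ n => exact norm_partialSum_le x n

theorem norm_le_of_forall_sum_range_le {x : ConvSeries} {B : ℝ}
    (h : ∀ n, ‖∑ k ∈ Finset.range n, x.seq k‖ ≤ B) : ‖x‖ ≤ B :=
  ciSup_le fun n => h (n + 1)

theorem norm_seq_le (x : ConvSeries) (n : ℕ) : ‖x.seq n‖ ≤ 2 * ‖x‖ := by
  have h : x.seq n = ∑ k ∈ Finset.range (n + 1), x.seq k - ∑ k ∈ Finset.range n, x.seq k := by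
    rw [Finset.sum_range_succ]
    ring
  rw [h]
  refine (norm_sub_le _ _).trans ?_
  linarith [x.norm_sum_range_le n, x.norm_sum_range_le (n + 1)]

theorem mem_of_cauchySeq {x : ℕ → ℂ} (h : CauchySeq fun n => ∑ k ∈ Finset.range n, x k) :
    x ∈ convSeriesSubmodule := by
  obtain ⟨l, hl⟩ := cauchySeq_tendsto_of_complete h
  exact ⟨l, hl.comp (tendsto_add_atTop_nat 1)⟩

theorem mem_of_summable {x : ℕ → ℂ} (h : Summable x) : x ∈ convSeriesSubmodule :=
  mem_of_cauchySeq h.hasSum.tendsto_sum_nat.cauchySeq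

/-- The element of `cs` given by a sequence whose series converges. -/
def ofSeq (x : ℕ → ℂ) (h : x ∈ convSeriesSubmodule) : ConvSeries := ⟨x, h⟩

@[simp] theorem seq_ofSeq (x : ℕ → ℂ) (h : x ∈ convSeriesSubmodule) : (ofSeq x h).seq = x := rfl

theorem cauchySeq_sum_range (x : ConvSeries) :
    CauchySeq fun n => ∑ k ∈ Finset.range n, x.seq k := by
  obtain ⟨l, hl⟩ := x.2
  exact ((tendsto_add_atTop_iff_nat 1).1 hl).cauchySeq

theorem seq_sub (x y : ConvSeries) : (x - y).seq = x.seq - y.seq := rfl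

/-- The `n`-th coordinate functional on `cs`. -/
noncomputable def coord (n : ℕ) : ConvSeries →L[ℂ] ℂ :=
  LinearMap.mkContinuous
    { toFun := fun x => x.seq n
      map_add' := fun _ _ => rfl
      map_smul' := fun _ _ => rfl } 2 fun x => x.norm_seq_le n

@[simp] theorem coord_apply (n : ℕ) (x : ConvSeries) : coord n x = x.seq n := rfl

/-- The `n`-th unit vector of `cs`. -/
noncomputable def single (n : ℕ) : ConvSeries :=
  ofSeq (Pi.single n 1) (mem_of_summable (summable_of_hasFiniteSupport
    ((Set.finite_singleton n).subset (Pi.support_single_subset))))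

theorem seq_single (n : ℕ) : (single n).seq = Pi.single n 1 := rfl

instance : Nontrivial ConvSeries :=
  ⟨⟨single 0, 0, fun h => one_ne_zero (α := ℂ) (by
    simpa [seq_single, seq_zero] using congrFun (congrArg seq h) 0)⟩⟩

instance : CompleteSpace ConvSeries := by
  refine Metric.complete_of_cauchySeq_tendsto fun u hu => ?_
  have hc : ∀ n, ∃ a, Tendsto (fun m => (u m).seq n) atTop (𝓝 a) := fun n =>
    cauchySeq_tendsto_of_complete (hu.map (coord n).uniformContinuous)
  choose x hx using hc
  -- Uniformity in `n` gives both convergence of the limit series and convergence in norm.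
  have key : ∀ ε > 0, ∃ M, ∀ m ≥ M, ∀ n,
      ‖∑ k ∈ Finset.range n, (u m).seq k - ∑ k ∈ Finset.range n, x k‖ ≤ ε := by
    intro ε hε
    obtain ⟨M, hM⟩ := Metric.cauchySeq_iff.1 hu ε hε
    refine ⟨M, fun m hm n => ?_⟩
    have hlim : Tendsto (fun p => ‖∑ k ∈ Finset.range n, (u m).seq k
        - ∑ k ∈ Finset.range n, (u p).seq k‖) atTop
        (𝓝 ‖∑ k ∈ Finset.range n, (u m).seq k - ∑ k ∈ Finset.range n, x k‖) :=
      (tendsto_const_nhds.sub (tendsto_finsetSum _ fun k _ => hx k)).norm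
    refine le_of_tendsto hlim (eventually_atTop.2 ⟨M, fun p hp => ?_⟩)
    have h := (u m - u p).norm_sum_range_le n
    simp only [seq_sub, Pi.sub_apply, Finset.sum_sub_distrib] at h
    exact h.trans ((dist_eq_norm (u m) (u p)).symm.trans_le (hM m hm p hp).le)
  have hmem : x ∈ convSeriesSubmodule := by
    refine mem_of_cauchySeq (Metric.cauchySeq_iff'.2 fun ε hε => ?_)
    obtain ⟨M, hM⟩ := key (ε / 4) (by positivity)
    obtain ⟨N, hN⟩ := Metric.cauchySeq_iff'.1 (u M).cauchySeq_sum_range (ε / 4) (by positivity)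
    refine ⟨N, fun n hn => ?_⟩
    have h1 := hM M le_rfl n
    have h2 := hM M le_rfl N
    have h3 := hN n hn
    rw [← dist_eq_norm] at h1 h2
    rw [dist_comm] at h1
    linarith [dist_triangle4 (∑ k ∈ Finset.range n, x k) (∑ k ∈ Finset.range n, (u M).seq k)
      (∑ k ∈ Finset.range N, (u M).seq k) (∑ k ∈ Finset.range N, x k)]
  refine ⟨ofSeq x hmem, Metric.tendsto_atTop.2 fun ε hε => ?_⟩
  obtain ⟨M, hM⟩ := key (ε / 2) (by positivity)
  refine ⟨M, fun m hm => ?_⟩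
  rw [dist_eq_norm]
  refine (norm_le_of_forall_sum_range_le (B := ε / 2) fun n => ?_).trans_lt (by linarith)
  simpa [seq_sub] using hM m hm n

/-! ### The operator and its norm. -/

/-- Dirichlet's test: the convolution has bounded partial sums and the weights decrease to `0`. -/
theorem generalizedCesaro_mem {t : ℝ} (ht0 : 0 ≤ t) (ht1 : t < 1) (x : ConvSeries) :
    generalizedCesaro t x.seq ∈ convSeriesSubmodule := by
  refine mem_of_cauchySeq ?_
  have h := antitone_one_div_natCast_add_one.cauchySeq_series_mul_of_tendsto_zero_of_bounded
    tendsto_one_div_add_atTop_nhds_zero_nat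
    (norm_sum_range_geomConv_le ht0 ht1 x.norm_sum_range_le)
  simpa only [generalizedCesaro_eq_mul_geomConv, Complex.real_smul] using h

theorem norm_sum_range_generalizedCesaro_le {t : ℝ} (ht0 : 0 ≤ t) (x : ConvSeries) (N : ℕ) :
    ‖∑ n ∈ Finset.range N, generalizedCesaro t x.seq n‖
      ≤ (∑ j ∈ Finset.range N, t ^ j * (1 / ((j : ℝ) + 1))) * ‖x‖ := by
  simp only [generalizedCesaro_eq_mul_geomConv]
  exact norm_sum_range_mul_geomConv_le ht0 antitone_one_div_natCast_add_one
    (fun n => by positivity) x.norm_sum_range_le N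

theorem summable_pow_mul_one_div {t : ℝ} (ht0 : 0 ≤ t) (ht1 : t < 1) :
    Summable fun j : ℕ => t ^ j * (1 / ((j : ℝ) + 1)) :=
  (summable_geometric_of_lt_one ht0 ht1).of_nonneg_of_le (fun j => by positivity) fun j =>
    mul_le_of_le_one_right (pow_nonneg ht0 j) (by
      simpa using antitone_one_div_natCast_add_one (Nat.zero_le j))

/-- The generalized Cesàro operator on `cs`. -/
noncomputable def cesaro (t : ℝ) (ht0 : 0 ≤ t) (ht1 : t < 1) : ConvSeries →L[ℂ] ConvSeries :=
  LinearMap.mkContinuous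
    { toFun := fun x => ofSeq (generalizedCesaro t x.seq) (generalizedCesaro_mem ht0 ht1 x)
      map_add' := fun x y => seq_injective <| funext fun n => by
        simp [seq_add, generalizedCesaro, mul_add, Finset.sum_add_distrib, add_div]
      map_smul' := fun c x => seq_injective <| funext fun n => by
        simp only [seq_ofSeq, seq_smul, generalizedCesaro, Pi.smul_apply, smul_eq_mul,
          RingHom.id_apply, Finset.mul_sum, mul_div_assoc, Finset.sum_div]
        exact Finset.sum_congr rfl fun k _ => by ring }
    (∑' j : ℕ, t ^ j * (1 / ((j : ℝ) + 1))) fun x => norm_le_of_forall_sum_range_le fun N =>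
      (norm_sum_range_generalizedCesaro_le ht0 x N).trans <|
        mul_le_mul_of_nonneg_right ((summable_pow_mul_one_div ht0 ht1).sum_le_tsum _
          fun j _ => by positivity) (norm_nonneg x)

variable {t : ℝ} (ht0 : 0 ≤ t) (ht1 : t < 1)

theorem seq_cesaro (x : ConvSeries) : (cesaro t ht0 ht1 x).seq = generalizedCesaro t x.seq := rfl

theorem norm_single_zero_le : ‖single 0‖ ≤ 1 :=
  norm_le_of_forall_sum_range_le fun n => by
    cases n <;> simp [seq_single, Pi.single_apply]

/-- The vector `e_0` is extremal: its image is the sequence of terms of the bounding series. -/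
theorem norm_cesaro : ‖cesaro t ht0 ht1‖ = ∑' j : ℕ, t ^ j * (1 / ((j : ℝ) + 1)) := by
  refine le_antisymm (LinearMap.mkContinuous_norm_le _ (tsum_nonneg fun j => by positivity) _) ?_
  refine (summable_pow_mul_one_div ht0 ht1).tsum_le_of_sum_range_le fun N => ?_
  have h1 : ‖cesaro t ht0 ht1 (single 0)‖ ≤ ‖cesaro t ht0 ht1‖ :=
    ((cesaro t ht0 ht1).le_opNorm _).trans
      (mul_le_of_le_one_right (norm_nonneg _) norm_single_zero_le)
  refine le_trans ?_ (((cesaro t ht0 ht1 (single 0)).norm_sum_range_le N).trans h1)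
  have h2 : ∀ n, (cesaro t ht0 ht1 (single 0)).seq n
      = ((t ^ n * (1 / ((n : ℝ) + 1)) : ℝ) : ℂ) := by
    intro n
    simp [seq_cesaro, generalizedCesaro, seq_single, Finset.sum_range_succ', div_eq_mul_inv]
  simp only [h2]
  rw [← Complex.ofReal_sum]
  exact (Complex.ofReal_re _).symm.trans_le (Complex.re_le_norm _)

theorem norm_cesaro_of_pos (ht : 0 < t) : ‖cesaro t ht0 ht1‖ = t⁻¹ * Real.log (1 / (1 - t)) := by
  rw [norm_cesaro, one_div (1 - t), Real.log_inv]
  have h := (Real.hasSum_pow_div_log_of_abs_lt_one (x := t) (by rwa [abs_of_pos ht])).mul_left t⁻¹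
  rw [← h.tsum_eq]
  refine tsum_congr fun j => ?_
  field_simp
  ring

theorem norm_cesaro_of_eq_zero (ht : t = 0) : ‖cesaro t ht0 ht1‖ = 1 := by
  rw [norm_cesaro, tsum_eq_single 0 fun j hj => by simp [ht, hj]]
  simp

/-! ### Compactness by finite-rank approximation. -/

/-- The truncation of the generalized Cesàro operator to the first `M` coordinates. -/
noncomputable def cesaroTrunc (M : ℕ) : ConvSeries →L[ℂ] ConvSeries :=
  ∑ k ∈ Finset.range M, ((coord k).comp (cesaro t ht0 ht1)).smulRight (single k)

theorem isCompactOperator_smulRight (f : ConvSeries →L[ℂ] ℂ) (y : ConvSeries) :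
    IsCompactOperator (f.smulRight y) := by
  have h : IsCompactOperator ((1 : ℂ →L[ℂ] ℂ).smulRight y : ℂ →L[ℂ] ConvSeries) :=
    isCompactOperator_of_locallyCompactSpace_rng ((1 : ℂ →L[ℂ] ℂ).smulRight y)
  convert! h.comp_clm f using 1

theorem isCompactOperator_cesaroTrunc (M : ℕ) : IsCompactOperator (cesaroTrunc ht0 ht1 M) :=
  Submodule.sum_mem (compactOperator (RingHom.id ℂ) ConvSeries ConvSeries) fun _ _ =>
    isCompactOperator_smulRight _ _

theorem seq_cesaroTrunc (M : ℕ) (x : ConvSeries) (n : ℕ) :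
    (cesaroTrunc ht0 ht1 M x).seq n = if n < M then (cesaro t ht0 ht1 x).seq n else 0 := by
  rw [← coord_apply]
  simp [cesaroTrunc, seq_single, Pi.single_apply]

theorem norm_cesaro_sub_trunc_le (M : ℕ) :
    ‖cesaro t ht0 ht1 - cesaroTrunc ht0 ht1 M‖ ≤ 2 * (1 - t)⁻¹ * (1 / ((M : ℝ) + 1)) := by
  have ht : 0 < 1 - t := sub_pos.2 ht1
  refine ContinuousLinearMap.opNorm_le_bound _ (by positivity) fun x => ?_
  refine norm_le_of_forall_sum_range_le fun N => ?_
  have hs : ∀ n, ((cesaro t ht0 ht1 - cesaroTrunc ht0 ht1 M) x).seq n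
      = if n < M then 0 else (cesaro t ht0 ht1 x).seq n := by
    intro n
    rw [sub_apply, seq_sub, Pi.sub_apply, seq_cesaroTrunc]
    split_ifs <;> simp
  -- A block starting at `M` is a difference of two partial sums, whence the factor `2`.
  have hB : ∀ n, ‖∑ k ∈ Finset.range n, geomConv t x.seq (M + k)‖
      ≤ (1 - t)⁻¹ * ‖x‖ + (1 - t)⁻¹ * ‖x‖ := by
    intro n
    have e : ∑ k ∈ Finset.range n, geomConv t x.seq (M + k)
        = ∑ k ∈ Finset.range (M + n), geomConv t x.seq k
          - ∑ k ∈ Finset.range M, geomConv t x.seq k := by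
      rw [Finset.sum_range_add]
      ring
    rw [e]
    exact (norm_sub_le _ _).trans (add_le_add
      (norm_sum_range_geomConv_le ht0 ht1 x.norm_sum_range_le _)
      (norm_sum_range_geomConv_le ht0 ht1 x.norm_sum_range_le _))
  simp only [hs]
  rcases le_total N M with h | h
  · rw [Finset.sum_eq_zero fun n hn => if_pos ((Finset.mem_range.1 hn).trans_le h), norm_zero]
    positivity
  · obtain ⟨i, rfl⟩ := Nat.exists_eq_add_of_le h
    rw [Finset.sum_range_add, Finset.sum_eq_zero fun n hn => if_pos (Finset.mem_range.1 hn),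
      zero_add]
    have hA := norm_sum_range_mul_le_of_antitone (w := fun k => 1 / (((M + k : ℕ) : ℝ) + 1))
      (fun a b h => antitone_one_div_natCast_add_one (Nat.add_le_add_left h M))
      (fun n => by positivity) hB i
    simp only [Nat.not_lt.2 (Nat.le_add_right M _), if_false, seq_cesaro,
      generalizedCesaro_eq_mul_geomConv]
    refine hA.trans_eq ?_
    rw [Nat.add_zero]
    ring

theorem isCompactOperator_cesaro : IsCompactOperator (cesaro t ht0 ht1) := by
  refine isCompactOperator_of_tendsto (F := fun M => cesaroTrunc ht0 ht1 M) (l := atTop) ?_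
    (Eventually.of_forall (isCompactOperator_cesaroTrunc ht0 ht1))
  rw [tendsto_iff_norm_sub_tendsto_zero]
  refine squeeze_zero (fun _ => norm_nonneg _)
    (fun M => (norm_sub_rev _ _).trans_le (norm_cesaro_sub_trunc_le ht0 ht1 M)) ?_
  simpa using tendsto_one_div_add_atTop_nhds_zero_nat.const_mul (2 * (1 - t)⁻¹)

end ConvSeries

/-! ### Spectral radius, powers and compact operators. -/

section BanachAlgebra

variable {A : Type*} [NormedRing A] [NormedAlgebra ℂ A] [CompleteSpace A]

/-- By Gelfand's formula, `‖a ^ n‖ ≤ c ^ n` eventually, for some `c < 1`. -/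
theorem tendsto_pow_atTop_nhds_zero_of_spectralRadius_lt_one {a : A}
    (ha : spectralRadius ℂ a < 1) : Tendsto (fun n : ℕ => a ^ n) atTop (𝓝 0) := by
  obtain ⟨c, hac, hc1⟩ := ENNReal.lt_iff_exists_nnreal_btwn.1 ha
  have hc1' : c < 1 := by exact_mod_cast hc1
  have hev := (spectrum.pow_nnnorm_pow_one_div_tendsto_nhds_spectralRadius a).eventually_lt_const hac
  refine squeeze_zero_norm' ?_ (tendsto_pow_atTop_nhds_zero_of_lt_one c.coe_nonneg hc1')
  filter_upwards [hev, eventually_ge_atTop 1] with n hn hn1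
  have hn0 : (0 : ℝ) < n := by exact_mod_cast hn1
  rw [one_div, ENNReal.rpow_inv_lt_iff hn0, ENNReal.rpow_natCast] at hn
  exact_mod_cast hn.le

/-- All mixed products vanish. The exponent starts at `1`, since at `0` the right side would be `p +
1`. -/
theorem pow_succ_add_of_mul_eq_zero {R : Type*} [Ring R] {p q : R} (hp : p * p = p)
    (hpq : p * q = 0) (hqp : q * p = 0) (n : ℕ) : (p + q) ^ (n + 1) = p + q ^ (n + 1) := by
  induction n with
  | zero => simp
  | succ n ih =>
    rw [pow_succ, ih, add_mul, mul_add, mul_add, hp, hpq, pow_succ q n, mul_assoc _ q p, hqp,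
      pow_succ q (n + 1), pow_succ q n]
    simp

end BanachAlgebra

section Operators

variable {X : Type*} [NormedAddCommGroup X] [NormedSpace ℂ X] {T P : X →L[ℂ] X}

theorem isPowerBounded_of_tendsto_pow (h : Tendsto (fun n : ℕ => T ^ n) atTop (𝓝 P)) :
    IsPowerBounded T := by
  obtain ⟨M, hM⟩ := h.norm.bddAbove_range
  exact ⟨M, fun n _ => hM ⟨n, rfl⟩⟩

theorem isUniformlyMeanErgodic_of_tendsto_pow (h : Tendsto (fun n : ℕ => T ^ n) atTop (𝓝 P)) :
    IsUniformlyMeanErgodic T := by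
  refine ⟨P, ((h.comp (tendsto_add_atTop_nat 1)).cesaro_smul).congr fun n => ?_⟩
  have hsum : ∑ m ∈ Finset.Icc 1 n, T ^ m = ∑ m ∈ Finset.range n, T ^ (m + 1) := by
    rw [← Finset.Ico_add_one_right_eq_Icc, Finset.sum_Ico_eq_sum_range, Nat.add_sub_cancel]
    simp only [add_comm]
  rw [cesaroMean, hsum, ← Complex.ofReal_natCast, ← Complex.ofReal_inv, Complex.coe_smul]
  rfl

theorem mem_pointSpectrum_iff {μ : ℂ} : μ ∈ pointSpectrum T ↔ ∃ x, x ≠ 0 ∧ T x = μ • x := by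
  have h := injective_iff_map_eq_zero (μ • ContinuousLinearMap.id ℂ X - T)
  simp only [pointSpectrum, Set.mem_ofPred_eq, h, not_forall]
  refine exists_congr fun x => ?_
  rw [exists_prop, and_comm, sub_apply, sub_eq_zero, eq_comm (a := T x)]
  rfl

theorem IsCompactOperator.mem_spectrum_iff [CompleteSpace X] (hT : IsCompactOperator T) {μ : ℂ}
    (hμ : μ ≠ 0) : μ ∈ spectrum ℂ T ↔ ∃ x, x ≠ 0 ∧ T x = μ • x := by
  rw [← hT.hasEigenvalue_iff_mem_spectrum hμ]
  constructor
  · intro h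
    obtain ⟨x, hx⟩ := h.exists_hasEigenvector
    exact ⟨x, hx.2, hx.apply_eq_smul⟩
  · rintro ⟨x, hx, h⟩
    exact Module.End.hasEigenvalue_of_hasEigenvector
      (Module.End.hasEigenvector_iff.2 ⟨Module.End.mem_eigenspace_iff.2 h, hx⟩)

/-- The spectrum is compact and nonempty, so the radius is attained and a strict bound on each
eigenvalue suffices. -/
theorem IsCompactOperator.spectralRadius_lt [CompleteSpace X] [Nontrivial X]
    (hT : IsCompactOperator T) {r : ℝ} (hr : 0 < r)
    (h : ∀ (μ : ℂ) (x : X), μ ≠ 0 → x ≠ 0 → T x = μ • x → ‖μ‖ < r) :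
    spectralRadius ℂ T < ENNReal.ofReal r := by
  refine spectrum.spectralRadius_lt_of_forall_lt T (r := r.toNNReal) fun μ hμ => ?_
  rw [Real.lt_toNNReal_iff_coe_lt, coe_nnnorm]
  by_cases h0 : μ = 0
  · simpa [h0] using hr
  · obtain ⟨x, hx, e⟩ := (hT.mem_spectrum_iff h0).1 hμ
    exact h μ x h0 hx e

end Operators

/-! ### Eigenvalues and spectrum. -/

/-- Once the powers of `t` merge, this is the hockey-stick identity. It evaluates `C_t` on its
eigenvectors. -/
theorem sum_range_choose_mul_pow (t : ℂ) (m n : ℕ) :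
    ∑ k ∈ Finset.range (n + 1), t ^ (n - k) * ((k.choose m : ℂ) * t ^ (k - m))
      = ((n + 1).choose (m + 1) : ℂ) * t ^ (n - m) := by
  have h : ∀ k ∈ Finset.range (n + 1), t ^ (n - k) * ((k.choose m : ℂ) * t ^ (k - m))
      = (k.choose m : ℂ) * t ^ (n - m) := by
    intro k hk
    have hk' : k ≤ n := Nat.lt_succ_iff.1 (Finset.mem_range.1 hk)
    rcases lt_or_ge k m with hm | hm
    · simp [Nat.choose_eq_zero_of_lt hm]
    · rw [mul_left_comm, ← pow_add, show n - k + (k - m) = n - m by lia]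
  rw [Finset.sum_congr rfl h, ← Finset.sum_mul]
  congr 1
  norm_cast
  clear h
  induction n with
  | zero => cases m <;> simp [Nat.choose]
  | succ n ih => rw [Finset.sum_range_succ, ih, Nat.choose_succ_succ (n + 1) m, add_comm]

namespace ConvSeries

variable {t : ℝ} (ht0 : 0 ≤ t) (ht1 : t < 1)

theorem exists_eigenvector_cesaro (m : ℕ) :
    ∃ x : ConvSeries, cesaro t ht0 ht1 x = (1 / ((m : ℂ) + 1)) • x ∧ x.seq m = 1 := by
  have hs : Summable fun n : ℕ => (n.choose m : ℂ) * (t : ℂ) ^ (n - m) := by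
    rw [← summable_nat_add_iff m]
    simpa using summable_choose_mul_geometric_of_norm_lt_one m (r := (t : ℂ))
      (by rwa [Complex.norm_of_nonneg ht0])
  refine ⟨ofSeq _ (mem_of_summable hs), seq_injective (funext fun n => ?_), by simp⟩
  have h := Nat.add_one_mul_choose_eq n m
  have hc : ((n : ℂ) + 1) * (n.choose m : ℂ) = ((n + 1).choose (m + 1) : ℂ) * ((m : ℂ) + 1) := by
    exact_mod_cast h
  have hn : (n : ℂ) + 1 ≠ 0 := Nat.cast_add_one_ne_zero n
  have hm : (m : ℂ) + 1 ≠ 0 := Nat.cast_add_one_ne_zero m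
  simp only [seq_cesaro, seq_ofSeq, generalizedCesaro, seq_smul, Pi.smul_apply, smul_eq_mul,
    sum_range_choose_mul_pow]
  field_simp
  linear_combination -(t : ℂ) ^ (n - m) * hc

/-- By triangularity, the first nonzero coordinate of `x` sees only the diagonal entry there. -/
theorem eigenvalue_cesaro {x : ConvSeries} (hx : x ≠ 0) {μ : ℂ}
    (h : cesaro t ht0 ht1 x = μ • x) : ∃ n : ℕ, μ = 1 / ((n : ℂ) + 1) ∧ x.seq n ≠ 0 := by
  have hex : ∃ n, x.seq n ≠ 0 := by
    by_contra! h0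
    exact hx (seq_injective (funext h0))
  classical
  refine ⟨Nat.find hex, ?_, Nat.find_spec hex⟩
  have h1 := congrFun (congrArg seq h) (Nat.find hex)
  have h2 : ∀ k ∈ Finset.range (Nat.find hex), (t : ℂ) ^ (Nat.find hex - k) * x.seq k = 0 :=
    fun k hk => by rw [not_not.1 (Nat.find_min hex (Finset.mem_range.1 hk)), mul_zero]
  rw [seq_cesaro, generalizedCesaro, Finset.sum_range_succ, Finset.sum_eq_zero h2, seq_smul,
    Pi.smul_apply, smul_eq_mul, Nat.sub_self, pow_zero, zero_add, one_mul, div_eq_inv_mul,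
    ← one_div] at h1
  exact (mul_right_cancel₀ (Nat.find_spec hex) h1).symm

theorem exists_eigenvector_cesaro_iff {μ : ℂ} :
    (∃ x, x ≠ 0 ∧ cesaro t ht0 ht1 x = μ • x) ↔ ∃ n : ℕ, μ = 1 / ((n : ℂ) + 1) := by
  constructor
  · rintro ⟨x, hx, h⟩
    obtain ⟨n, hn, -⟩ := eigenvalue_cesaro ht0 ht1 hx h
    exact ⟨n, hn⟩
  · rintro ⟨n, rfl⟩
    obtain ⟨x, h, hx⟩ := exists_eigenvector_cesaro ht0 ht1 n
    refine ⟨x, ?_, h⟩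
    rintro rfl
    simp [seq_zero] at hx

theorem pointSpectrum_cesaro :
    pointSpectrum (cesaro t ht0 ht1) = {μ : ℂ | ∃ n : ℕ, μ = 1 / ((n : ℂ) + 1)} :=
  Set.ext fun _ => mem_pointSpectrum_iff.trans (exists_eigenvector_cesaro_iff ht0 ht1)

theorem spectrum_cesaro :
    spectrum ℂ (cesaro t ht0 ht1) = {μ : ℂ | ∃ n : ℕ, μ = 1 / ((n : ℂ) + 1)} ∪ {0} := by
  have key : ∀ μ : ℂ, μ ≠ 0 →
      (μ ∈ spectrum ℂ (cesaro t ht0 ht1) ↔ ∃ n : ℕ, μ = 1 / ((n : ℂ) + 1)) := fun μ hμ =>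
    ((isCompactOperator_cesaro ht0 ht1).mem_spectrum_iff hμ).trans
      (exists_eigenvector_cesaro_iff ht0 ht1)
  -- The spectrum is closed and `1 / (n + 1) → 0`.
  have h0 : (0 : ℂ) ∈ spectrum ℂ (cesaro t ht0 ht1) :=
    (spectrum.isClosed (𝕜 := ℂ) (cesaro t ht0 ht1)).mem_of_tendsto
      tendsto_one_div_add_atTop_nhds_zero_nat (Eventually.of_forall fun n =>
        (key _ (one_div_ne_zero (Nat.cast_add_one_ne_zero n))).2 ⟨n, rfl⟩)
  ext μ
  by_cases hμ : μ = 0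
  · simp [hμ, h0]
  · simp [hμ, key μ hμ]

theorem seq_cesaro_zero (x : ConvSeries) : (cesaro t ht0 ht1 x).seq 0 = x.seq 0 := by
  simp [seq_cesaro, generalizedCesaro]

theorem seq_cesaro_one (x : ConvSeries) :
    (cesaro t ht0 ht1 x).seq 1 = (t * x.seq 0 + x.seq 1) / 2 := by
  norm_num [seq_cesaro, generalizedCesaro, Finset.sum_range_succ]

/-! ### Convergence of the powers. -/

theorem exists_tendsto_pow_cesaro :
    ∃ P, Tendsto (fun n : ℕ => cesaro t ht0 ht1 ^ n) atTop (𝓝 P) := by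
  obtain ⟨v, hv, hv0⟩ := exists_eigenvector_cesaro ht0 ht1 0
  replace hv : cesaro t ht0 ht1 v = v := by simpa using hv
  set T := cesaro t ht0 ht1 with hT
  set P : ConvSeries →L[ℂ] ConvSeries := (coord 0).smulRight v with hP
  have hPx : ∀ x, P x = x.seq 0 • v := fun x => by simp [hP]
  have hPP : P * P = P := ContinuousLinearMap.ext fun x => by
    simp [hPx, seq_smul, hv0]
  have hTP : T * P = P := ContinuousLinearMap.ext fun x => by
    simp [hPx, hv]
  have hPT : P * T = P := ContinuousLinearMap.ext fun x => by
    simp [hPx, hT, seq_cesaro_zero]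
  have hQ : spectralRadius ℂ (T - P) < 1 := by
    rw [← ENNReal.ofReal_one]
    refine ((isCompactOperator_cesaro ht0 ht1).sub
      (isCompactOperator_smulRight _ v)).spectralRadius_lt one_pos fun μ x hμ hx h => ?_
    -- `T` and `P` both preserve coordinate `0`, so `T - P` kills it. Hence `x` is an eigenvector of
    -- `T` whose eigenvalue is not that of index `0`.
    have h0 : x.seq 0 = 0 := by
      have e := congrFun (congrArg seq h) 0
      rw [sub_apply, hPx, seq_sub, Pi.sub_apply, seq_smul, seq_smul, Pi.smul_apply,
        Pi.smul_apply, hv0, hT, seq_cesaro_zero] at e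
      simpa [hμ] using e.symm
    rw [sub_apply, hPx, h0, zero_smul, sub_zero] at h
    obtain ⟨n, rfl, hn⟩ := eigenvalue_cesaro ht0 ht1 hx h
    have hn0 : n ≠ 0 := by
      rintro rfl
      exact hn h0
    rw [norm_div, norm_one, ← Nat.cast_add_one, Complex.norm_natCast,
      div_lt_one (by positivity)]
    exact_mod_cast Nat.lt_add_of_pos_left (Nat.pos_of_ne_zero hn0)
  refine ⟨P, (tendsto_add_atTop_iff_nat 1).1 ?_⟩
  have hlim := (tendsto_const_nhds (x := P)).add
    ((tendsto_pow_atTop_nhds_zero_of_spectralRadius_lt_one hQ).comp (tendsto_add_atTop_nat 1))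
  rw [add_zero] at hlim
  refine hlim.congr fun n => ?_
  have hpow := pow_succ_add_of_mul_eq_zero (p := P) (q := T - P) hPP
    (by rw [mul_sub, hPT, hPP, sub_self]) (by rw [sub_mul, hTP, hPP, sub_self]) n
  rw [add_sub_cancel] at hpow
  exact hpow.symm

/-! ### Failure of supercyclicity. -/

theorem not_isSupercyclic_cesaro : ¬ IsSupercyclic (cesaro t ht0 ht1) := by
  rintro ⟨x, hx⟩
  -- `f` is an eigenvector of the adjoint for `1 / 2`, as `coord 0` is for `1`.
  set f : ConvSeries →L[ℂ] ℂ := coord 1 - (t : ℂ) • coord 0 with hf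
  have hfx : ∀ y, f y = y.seq 1 - t * y.seq 0 := fun y => by simp [hf]
  have h0 : ∀ n, ((cesaro t ht0 ht1 ^ n) x).seq 0 = x.seq 0 := by
    intro n
    induction n with
    | zero => simp
    | succ n ih => rw [pow_succ', mul_apply_eq_comp, seq_cesaro_zero, ih]
  have h1 : ∀ n, f ((cesaro t ht0 ht1 ^ n) x) = f x / 2 ^ n := by
    intro n
    induction n with
    | zero => simp
    | succ n ih =>
      rw [pow_succ', mul_apply_eq_comp, hfx, seq_cesaro_zero, seq_cesaro_one,
        pow_succ, ← div_div, ← ih, hfx]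
      ring
  -- Along the orbit `|f y| / |y_0|` never exceeds its value at `x`. Without division this is a
  -- closed condition, so density extends it to all `y`.
  have hle : ∀ y, ‖f y‖ * ‖x.seq 0‖ ≤ ‖y.seq 0‖ * ‖f x‖ := by
    have hcl : IsClosed {y : ConvSeries | ‖f y‖ * ‖x.seq 0‖ ≤ ‖coord 0 y‖ * ‖f x‖} :=
      isClosed_le (by fun_prop) (by fun_prop)
    intro y
    refine (hcl.closure_subset_iff.2 ?_ (hx y) :)
    rintro _ ⟨μ, n, rfl⟩
    simp only [Set.mem_ofPred_eq, map_smul, h1, coord_apply, seq_smul, Pi.smul_apply, h0,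
      smul_eq_mul, norm_mul, norm_div, norm_pow, Complex.norm_ofNat]
    have h2 : ‖f x‖ / 2 ^ n ≤ ‖f x‖ :=
      div_le_self (norm_nonneg _) (one_le_pow₀ one_le_two)
    calc ‖μ‖ * (‖f x‖ / 2 ^ n) * ‖x.seq 0‖ ≤ ‖μ‖ * ‖f x‖ * ‖x.seq 0‖ := by gcongr
      _ = ‖μ‖ * ‖x.seq 0‖ * ‖f x‖ := by ring
  -- At `e_1` the right side is `0` and `f` equals `1`. The orbit then lies in the closed hyperplane
  -- `y_0 = 0`, which misses `e_0`.
  have hx0 : x.seq 0 = 0 := by simpa [hfx, seq_single] using hle (single 1)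
  have hcl : IsClosed {y : ConvSeries | coord 0 y = 0} := isClosed_eq (by fun_prop) (by fun_prop)
  have : coord 0 (single 0) = 0 := by
    refine (hcl.closure_subset_iff.2 ?_ (hx (single 0)) :)
    rintro _ ⟨μ, n, rfl⟩
    rw [Set.mem_ofPred_eq, map_smul, coord_apply, h0, hx0, smul_zero]
  simp [seq_single] at this

end ConvSeries

theorem propositionP6p1 (t : ℝ) (ht0 : 0 ≤ t) (ht1 : t < 1) :
    ∃ T : ConvSeries →L[ℂ] ConvSeries,
      (∀ x : ConvSeries, (T x).seq = generalizedCesaro t x.seq) ∧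
      (t = 0 → ‖T‖ = 1) ∧
      (0 < t → ‖T‖ = t⁻¹ * Real.log (1 / (1 - t))) ∧
      IsCompactOperator T ∧
      pointSpectrum T = {μ : ℂ | ∃ n : ℕ, μ = 1 / ((n : ℂ) + 1)} ∧
      spectrum ℂ T = {μ : ℂ | ∃ n : ℕ, μ = 1 / ((n : ℂ) + 1)} ∪ {0} ∧
      IsPowerBounded T ∧
      IsUniformlyMeanErgodic T ∧
      ¬ IsSupercyclic T := by
  obtain ⟨P, hP⟩ := ConvSeries.exists_tendsto_pow_cesaro ht0 ht1
  exact ⟨ConvSeries.cesaro t ht0 ht1, ConvSeries.seq_cesaro ht0 ht1,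
    ConvSeries.norm_cesaro_of_eq_zero ht0 ht1, ConvSeries.norm_cesaro_of_pos ht0 ht1,
    ConvSeries.isCompactOperator_cesaro ht0 ht1, ConvSeries.pointSpectrum_cesaro ht0 ht1,
    ConvSeries.spectrum_cesaro ht0 ht1, isPowerBounded_of_tendsto_pow hP,
    isUniformlyMeanErgodic_of_tendsto_pow hP, ConvSeries.not_isSupercyclic_cesaro ht0 ht1⟩
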